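/- Let $(X,d)$ be a complete and separable metric space, $p\in(1,+\infty)$ and $T>0$. Let $\mathrm C([0,T];X)$ be the space of continuous curves with the supremum distance $d_\infty$. For a complete separable metric space $(Y,\rho)$ let $\mathcal P_p(Y)$ be the set of Borel probability measures $\mu$ on $Y$ with $\int \rho(y,y_0)^p\,\mathrm d\mu(y)<+\infty$ for some (hence any) $y_0\in Y$, endowed with the $p$-Wasserstein distance $W_p(\mu,\nu)=\bigl(\inf_{\pi}\int \rho(y,y')^p\,\mathrm d\pi(y,y')\bigr)^{1/p}$, the infimum being over all couplings $\pi$ of $\mu$ and $\nu$; let $\mathrm C([0,T];\mathcal P_p(X))$ carry the topology of uniform convergence. Write $\mathsf e_t(\gamma)=\gamma(t)$, and let $\mathrm{AC}^p([0,T];X)$ be the set of curves $\gamma$ for which there is $m\in L^p(0,T)$ with $d(\gamma_s,\gamma_t)\le\int_s^t m(r)\,\mathrm dr$ for all $0\le s\le t\le T$. Define the $p$-action $\mathcal A_p:\mathrm C([0,T];X)\to[0,+\infty]$ by $$\mathcal A_p(\gamma)=\int_0^T|\dot\gamma_t|_d^p\,\mathrm dt\ \text{ if }\gamma\in\mathrm{AC}^p([0,T];X),\qquad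 \mathcal A_p(\gamma)=+\infty\ \text{ otherwise},$$ where $|\dot\gamma_t|_d=\lim_{s\to t}d(\gamma_s,\gamma_t)/|s-t|$ is the metric derivative (which exists for a.e. $t$ if $\gamma\in \mathrm{AC}^p([0,T];X)$). Let $\mathcal K\subset\mathcal P_p(\mathrm C([0,T];X))$ be such that 1. $\sup_{\boldsymbol\eta\in\mathcal K}\int\mathcal A_p\,\mathrm d\boldsymbol\eta<+\infty$; 2. $\sup\{d(x,x_0): x\in\operatorname{supp}((\mathsf e_0)_\sharp\boldsymbol\eta),\ \boldsymbol\eta\in\mathcal K\}<+\infty$ for some (hence for any) $x_0\in X$; 3. the set of curves $\{(t\mapsto(\mathsf e_t)_\sharp\boldsymbol\eta):\boldsymbol\eta\in\mathcal K\}$ is relatively compact in $\mathrm C([0,T];\mathcal P_p(X))$. Then $\mathcal K$ is relatively compact in $\mathcal P_p(\mathrm C([0,T];X))$. -/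

import Mathlib

open MeasureTheory ProbabilityTheory Filter Topology Set
open scoped ENNReal

noncomputable section

/-- `𝒫_p(X)`: the Borel probability measures on `X` with finite `p`-moment, i.e.
`∫ d(x, x₀)^p dμ(x) < ∞` for some (equivalently, any) `x₀`. It carries the topology of the
`p`-Wasserstein distance, defined below (not the narrow topology). -/
structure WassersteinSpace (p : ℝ) (X : Type*) [MetricSpace X] [MeasurableSpace X] where
  /-- The underlying probability measure. -/
  toMeasure : Measure X
  /-- It has total mass one. -/
  isProb : IsProbabilityMeasure toMeasure
  /-- It has finite `p`-moment. -/
  moment : ∃ x₀ : X, ∫⁻ x, edist x x₀ ^ p ∂toMeasure < ∞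

attribute [instance] WassersteinSpace.isProb

/-- `Γ(μ, ν)`: the couplings of `μ` and `ν`. -/
def couplings {X : Type*} [MeasurableSpace X] (μ ν : Measure X) : Set (Measure (X × X)) :=
  {π | π.fst = μ ∧ π.snd = ν}

lemma swap_mem_couplings {X : Type*} [MeasurableSpace X] {μ ν : Measure X} {π : Measure (X × X)} (hπ : π ∈ couplings μ ν) :
    π.map Prod.swap ∈ couplings ν μ := by
  refine ⟨?_, ?_⟩
  · rw [Measure.fst_map_swap]; exact hπ.2
  · rw [Measure.snd_map_swap]; exact hπ.1

/-- The `p`-Wasserstein distance `W_p(μ, ν) = (inf_{π ∈ Γ(μ, ν)} ∫ d(x, y)^p dπ(x, y))^{1/p}`. -/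
def wassersteinDist {X : Type*} [MetricSpace X] [MeasurableSpace X] (p : ℝ) (μ ν : Measure X) :
    ℝ≥0∞ :=
  (⨅ π ∈ couplings μ ν, ∫⁻ z, edist z.1 z.2 ^ p ∂π) ^ (1 / p)

section Wasserstein

variable {X : Type*} [MetricSpace X] [MeasurableSpace X]

lemma wassersteinDist_le {p : ℝ} (hp : 1 ≤ p) {μ ν : Measure X} {π : Measure (X × X)}
    (hπ : π ∈ couplings μ ν) :
    wassersteinDist p μ ν ≤ (∫⁻ z, edist z.1 z.2 ^ p ∂π) ^ (1 / p) :=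
  ENNReal.rpow_le_rpow (iInf₂_le π hπ) (by positivity)

lemma exists_coupling_of_wassersteinDist_lt {p : ℝ} (hp : 1 ≤ p) {μ ν : Measure X} {c : ℝ≥0∞}
    (h : wassersteinDist p μ ν < c) :
    ∃ π ∈ couplings μ ν, (∫⁻ z, edist z.1 z.2 ^ p ∂π) ^ (1 / p) < c := by
  have hp0 : 0 < p := by linarith
  have h' : (⨅ π ∈ couplings μ ν, ∫⁻ z, edist z.1 z.2 ^ p ∂π) < c ^ p := by
    rw [wassersteinDist, one_div] at h
    exact (ENNReal.rpow_inv_lt_iff hp0).1 h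
  simp only [iInf_lt_iff] at h'
  obtain ⟨π, hπ, hlt⟩ := h'
  refine ⟨π, hπ, ?_⟩
  rw [one_div]
  exact (ENNReal.rpow_inv_lt_iff hp0).2 hlt

variable [SecondCountableTopology X] [BorelSpace X]

lemma wassersteinDist_self {p : ℝ} (hp : 1 ≤ p) (μ : Measure X) : wassersteinDist p μ μ = 0 := by
  have hp0 : 0 < p := by linarith
  have hm : Measurable fun x : X => (x, x) := by fun_prop
  have hπ : μ.map (fun x => (x, x)) ∈ couplings μ μ := by
    constructor
    · rw [Measure.fst, Measure.map_map measurable_fst hm]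
      exact Measure.map_id
    · rw [Measure.snd, Measure.map_map measurable_snd hm]
      exact Measure.map_id
  refine le_antisymm ((wassersteinDist_le hp hπ).trans ?_) zero_le
  rw [lintegral_map (by fun_prop) hm]
  simp [hp0]

lemma wassersteinDist_comm_le {p : ℝ} (μ ν : Measure X) :
    (⨅ π ∈ couplings μ ν, ∫⁻ z, edist z.1 z.2 ^ p ∂π)
      ≤ ⨅ π ∈ couplings ν μ, ∫⁻ z, edist z.1 z.2 ^ p ∂π := by
  refine le_iInf₂ fun π hπ => (iInf₂_le _ (swap_mem_couplings hπ)).trans ?_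
  rw [lintegral_map (by fun_prop) measurable_swap]
  simp [edist_comm]

lemma wassersteinDist_comm (p : ℝ) (μ ν : Measure X) :
    wassersteinDist p μ ν = wassersteinDist p ν μ := by
  rw [wassersteinDist, wassersteinDist,
    le_antisymm (wassersteinDist_comm_le μ ν) (wassersteinDist_comm_le ν μ)]

variable [CompleteSpace X]

lemma exists_gluing {μ ν ρ : Measure X} [IsProbabilityMeasure ν] {π₁ π₂ : Measure (X × X)}
    (h₁ : π₁ ∈ couplings μ ν) (h₂ : π₂ ∈ couplings ν ρ) :
    ∃ ω : Measure (X × X × X),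
      ω.map (fun z => (z.2.1, z.1)) = π₁ ∧ ω.map (fun z => (z.1, z.2.2)) = π₂ := by
  have : Nonempty X := nonempty_of_isProbabilityMeasure ν
  set π₁' : Measure (X × X) := π₁.map Prod.swap with hπ₁'
  have h₁' : π₁' ∈ couplings ν μ := swap_mem_couplings h₁
  have : IsProbabilityMeasure π₁' := ⟨by rw [← Measure.fst_univ, h₁'.1]; exact measure_univ⟩
  have : IsProbabilityMeasure π₂ := ⟨by rw [← Measure.fst_univ, h₂.1]; exact measure_univ⟩
  refine ⟨ν ⊗ₘ (π₁'.condKernel ×ₖ π₂.condKernel), ?_, ?_⟩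
  · have e : (ν ⊗ₘ (π₁'.condKernel ×ₖ π₂.condKernel)).map (fun z => (z.1, z.2.1)) = π₁' := by
      have := Measure.compProd_map (μ := ν) (κ := π₁'.condKernel ×ₖ π₂.condKernel)
        (f := Prod.fst) measurable_fst
      rw [← Kernel.fst_eq, Kernel.fst_prod, ← h₁'.1, π₁'.disintegrate π₁'.condKernel] at this
      rw [h₁'.1] at this
      exact this.symm
    have e2 : (ν ⊗ₘ (π₁'.condKernel ×ₖ π₂.condKernel)).map (fun z => (z.2.1, z.1))
        = π₁'.map Prod.swap := by
      conv_rhs => rw [← e]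
      rw [Measure.map_map measurable_swap (by fun_prop)]
      rfl
    rw [e2, hπ₁', Measure.map_map measurable_swap measurable_swap]
    simp
  · have := Measure.compProd_map (μ := ν) (κ := π₁'.condKernel ×ₖ π₂.condKernel)
      (f := Prod.snd) measurable_snd
    rw [← Kernel.snd_eq, Kernel.snd_prod, ← h₂.1, π₂.disintegrate π₂.condKernel] at this
    rw [h₂.1] at this
    exact this.symm

lemma wassersteinDist_triangle {p : ℝ} (hp : 1 ≤ p) (μ ν ρ : Measure X) [IsProbabilityMeasure ν] :
    wassersteinDist p μ ρ ≤ wassersteinDist p μ ν + wassersteinDist p ν ρ := by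
  have hp0 : 0 < p := by linarith
  refine ENNReal.le_of_forall_pos_le_add fun ε hε hfin => ?_
  have hε' : (ε : ℝ≥0∞) / 2 ≠ 0 := by simp [hε.ne']
  obtain ⟨hf₁, hf₂⟩ := ENNReal.add_lt_top.1 hfin
  obtain ⟨π₁, hπ₁, hlt₁⟩ := exists_coupling_of_wassersteinDist_lt hp
    (ENNReal.lt_add_right hf₁.ne hε')
  obtain ⟨π₂, hπ₂, hlt₂⟩ := exists_coupling_of_wassersteinDist_lt hp
    (ENNReal.lt_add_right hf₂.ne hε')
  obtain ⟨ω, hω₁, hω₂⟩ := exists_gluing hπ₁ hπ₂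
  have hω : ω.map (fun z => (z.2.1, z.2.2)) ∈ couplings μ ρ := by
    constructor
    · rw [← hπ₁.1, ← hω₁, Measure.fst, Measure.fst, Measure.map_map (by fun_prop) (by fun_prop),
        Measure.map_map (by fun_prop) (by fun_prop)]
      rfl
    · rw [← hπ₂.2, ← hω₂, Measure.snd, Measure.snd, Measure.map_map (by fun_prop) (by fun_prop),
        Measure.map_map (by fun_prop) (by fun_prop)]
      rfl
  refine (wassersteinDist_le hp hω).trans ?_
  rw [← hω₁, lintegral_map (by fun_prop) (by fun_prop)] at hlt₁
  rw [← hω₂, lintegral_map (by fun_prop) (by fun_prop)] at hlt₂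
  rw [lintegral_map (by fun_prop) (by fun_prop)]
  calc (∫⁻ z : X × X × X, edist z.2.1 z.2.2 ^ p ∂ω) ^ (1 / p)
      ≤ (∫⁻ z : X × X × X,
          ((fun z : X × X × X => edist z.2.1 z.1) + fun z : X × X × X => edist z.1 z.2.2) z ^ p
          ∂ω) ^ (1 / p) := by
        gcongr with z
        exact edist_triangle _ _ _
    _ ≤ (∫⁻ z : X × X × X, edist z.2.1 z.1 ^ p ∂ω) ^ (1 / p)
        + (∫⁻ z : X × X × X, edist z.1 z.2.2 ^ p ∂ω) ^ (1 / p) :=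
        ENNReal.lintegral_Lp_add_le (by fun_prop) (by fun_prop) hp
    _ ≤ (wassersteinDist p μ ν + ε / 2) + (wassersteinDist p ν ρ + ε / 2) :=
        add_le_add hlt₁.le hlt₂.le
    _ = wassersteinDist p μ ν + wassersteinDist p ν ρ + ε := by
        rw [add_add_add_comm, ENNReal.add_halves]

/-- `𝒫_p(X)` with the distance `W_p`; all topological notions on `𝒫_p(X)` refer to it. -/
instance WassersteinSpace.instPseudoEMetricSpace {p : ℝ} [hp : Fact (1 ≤ p)] :
    PseudoEMetricSpace (WassersteinSpace p X) where
  edist μ ν := wassersteinDist p μ.toMeasure ν.toMeasure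
  edist_self μ := wassersteinDist_self hp.out μ.toMeasure
  edist_comm μ ν := wassersteinDist_comm p μ.toMeasure ν.toMeasure
  edist_triangle μ ν ρ := wassersteinDist_triangle hp.out μ.toMeasure ν.toMeasure ρ.toMeasure

end Wasserstein

section Paths

variable {X : Type*} [MetricSpace X] {T : ℝ}

/-- `C([0,T]; X)`, whose metric is the supremum distance, carries its Borel `σ`-algebra. -/
instance instMeasurableSpacePath : MeasurableSpace C(Icc (0 : ℝ) T, X) := borel _

instance instBorelSpacePath : BorelSpace C(Icc (0 : ℝ) T, X) := ⟨rfl⟩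

/-- `γ ∈ AC^p([0,T]; X)`: there is `m ∈ L^p(0,T)` with `d(γ_s, γ_t) ≤ ∫_s^t m(r) dr` for all
`0 ≤ s ≤ t ≤ T`. -/
def IsACp (p : ℝ) (γ : C(Icc (0 : ℝ) T, X)) : Prop :=
  ∃ m : ℝ → ℝ, MemLp m (ENNReal.ofReal p) (volume.restrict (Icc 0 T)) ∧
    ∀ s t : Icc (0 : ℝ) T, s ≤ t → dist (γ s) (γ t) ≤ ∫ r in (s : ℝ)..(t : ℝ), m r

/-- The metric derivative `|γ̇_t| = lim_{s → t} d(γ_s, γ_t) / |s - t|`. The limit exists for almost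
every `t` if `γ` is absolutely continuous; the upper limit extends the definition to every `t`. -/
def metricDerivative (γ : C(Icc (0 : ℝ) T, X)) (t : Icc (0 : ℝ) T) : ℝ≥0∞ :=
  limsup (fun s => edist (γ s) (γ t) / edist s t) (𝓝[≠] t)

open Classical in
/-- The `p`-action `𝒜_p(γ) = ∫_0^T |γ̇_t|^p dt` if `γ ∈ AC^p([0,T]; X)`, and `+∞` otherwise.
The measure `volume.comap Subtype.val` is the Lebesgue measure on `[0,T]`. -/
def pAction (p : ℝ) (γ : C(Icc (0 : ℝ) T, X)) : ℝ≥0∞ :=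
  if IsACp p γ then ∫⁻ t, metricDerivative γ t ^ p ∂(volume.comap Subtype.val) else ∞

lemma edist_evalPath_le (γ γ' : C(Icc (0 : ℝ) T, X)) (t : Icc (0 : ℝ) T) :
    edist (γ t) (γ' t) ≤ edist γ γ' := by
  rw [edist_dist, edist_dist]
  exact ENNReal.ofReal_le_ofReal (ContinuousMap.dist_apply_le_dist t)

variable [MeasurableSpace X] [BorelSpace X]

lemma measurable_evalPath (t : Icc (0 : ℝ) T) :
    Measurable fun γ : C(Icc (0 : ℝ) T, X) => γ t :=
  (ContinuousEvalConst.continuous_eval_const t).measurable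

/-- The marginal `(e_t)_♯ η ∈ 𝒫_p(X)` of `η ∈ 𝒫_p(C([0,T]; X))` at time `t`, where
`e_t(γ) = γ(t)`. -/
def marginal {p : ℝ} [hp : Fact (1 ≤ p)] (η : WassersteinSpace p C(Icc (0 : ℝ) T, X))
    (t : Icc (0 : ℝ) T) : WassersteinSpace p X where
  toMeasure := η.toMeasure.map fun γ => γ t
  isProb := Measure.isProbabilityMeasure_map (measurable_evalPath t).aemeasurable
  moment := by
    have hp0 : 0 ≤ p := by linarith [hp.out]
    obtain ⟨γ₀, hγ₀⟩ := η.moment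
    refine ⟨γ₀ t, ?_⟩
    have hm : Measurable fun x : X => edist x (γ₀ t) ^ p :=
      ((continuous_id.edist continuous_const).measurable).pow_const p
    rw [lintegral_map hm (measurable_evalPath t)]
    refine lt_of_le_of_lt (lintegral_mono fun γ => ?_) hγ₀
    exact ENNReal.rpow_le_rpow (edist_evalPath_le γ γ₀ t) hp0

variable [CompleteSpace X] [SecondCountableTopology X]

lemma continuous_marginal {p : ℝ} [hp : Fact (1 ≤ p)]
    (η : WassersteinSpace p C(Icc (0 : ℝ) T, X)) : Continuous (marginal η) := by
  have hp0 : 0 < p := by linarith [hp.out]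
  obtain ⟨γ₀, hγ₀⟩ := η.moment
  refine continuous_iff_continuousAt.2 fun t => tendsto_iff_edist_tendsto_0.2 ?_
  have hle : ∀ s, edist (marginal η s) (marginal η t)
      ≤ (∫⁻ γ, edist (γ s) (γ t) ^ p ∂η.toMeasure) ^ (1 / p) := by
    intro s
    have hm : Measurable fun γ : C(Icc (0 : ℝ) T, X) => (γ s, γ t) :=
      (measurable_evalPath s).prodMk (measurable_evalPath t)
    have hπ : η.toMeasure.map (fun γ => (γ s, γ t))
        ∈ couplings (marginal η s).toMeasure (marginal η t).toMeasure := by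
      constructor
      · rw [Measure.fst, Measure.map_map measurable_fst hm]; rfl
      · rw [Measure.snd, Measure.map_map measurable_snd hm]; rfl
    refine (wassersteinDist_le hp.out hπ).trans_eq ?_
    rw [lintegral_map (by fun_prop) hm]
  have hlim : Tendsto (fun s => ∫⁻ γ, edist (γ s) (γ t) ^ p ∂η.toMeasure) (𝓝 t) (𝓝 0) := by
    have hbase : ∫⁻ _ : C(Icc (0 : ℝ) T, X), (0 : ℝ≥0∞) ∂η.toMeasure = 0 := by simp
    rw [← hbase]
    obtain ⟨D, hD⟩ : ∃ D : ℝ, ∀ s, dist (γ₀ s) (γ₀ t) ≤ D := by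
      obtain ⟨D, hD⟩ := (isCompact_range γ₀.continuous).isBounded.subset_closedBall (γ₀ t)
      exact ⟨D, fun s => hD (mem_range_self s)⟩
    refine tendsto_lintegral_filter_of_dominated_convergence
      (fun γ => 2 ^ (p - 1) * ((2 * edist γ γ₀) ^ p + ENNReal.ofReal D ^ p)) ?_ ?_ ?_ ?_
    · refine Eventually.of_forall fun s => ?_
      exact ((measurable_evalPath s).edist (measurable_evalPath t)).pow_const p
    · refine Eventually.of_forall fun s => Eventually.of_forall fun γ => ?_
      have h1 : edist (γ s) (γ t) ≤ 2 * edist γ γ₀ + ENNReal.ofReal D := by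
        calc edist (γ s) (γ t)
            ≤ edist (γ s) (γ₀ s) + edist (γ₀ s) (γ₀ t) + edist (γ₀ t) (γ t) :=
              edist_triangle4 _ _ _ _
          _ ≤ edist γ γ₀ + ENNReal.ofReal D + edist γ γ₀ := by
              gcongr
              · exact edist_evalPath_le _ _ _
              · rw [edist_dist]; exact ENNReal.ofReal_le_ofReal (hD s)
              · rw [edist_comm]; exact edist_evalPath_le _ _ _
          _ = _ := by ring
      exact (ENNReal.rpow_le_rpow h1 hp0.le).trans
        (ENNReal.rpow_add_le_mul_rpow_add_rpow _ _ hp.out)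
    · have hmeas : Measurable fun γ : C(Icc (0 : ℝ) T, X) => (2 * edist γ γ₀) ^ p :=
        (((continuous_id.edist continuous_const).measurable).const_mul 2).pow_const p
      rw [lintegral_const_mul _ (hmeas.add_const _), lintegral_add_left hmeas]
      refine ENNReal.mul_ne_top (by finiteness) (ENNReal.add_ne_top.2 ⟨?_, ?_⟩)
      · have hmeas' : Measurable fun γ : C(Icc (0 : ℝ) T, X) => edist γ γ₀ ^ p :=
          ((continuous_id.edist continuous_const).measurable).pow_const p
        simp_rw [ENNReal.mul_rpow_of_nonneg _ _ hp0.le]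
        rw [lintegral_const_mul _ hmeas']
        exact ENNReal.mul_ne_top (by finiteness) hγ₀.ne
      · simp only [lintegral_const, measure_univ, mul_one]
        finiteness
    · refine Eventually.of_forall fun γ => ?_
      have h1 : Tendsto (fun s => edist (γ s) (γ t)) (𝓝 t) (𝓝 0) :=
        tendsto_iff_edist_tendsto_0.1 (γ.continuous.tendsto t)
      have h2 := h1.ennrpow_const p
      rwa [ENNReal.zero_rpow_of_pos hp0] at h2
  have hlim' := hlim.ennrpow_const (1 / p)
  rw [ENNReal.zero_rpow_of_pos (by positivity)] at hlim'
  exact tendsto_of_tendsto_of_tendsto_of_le_of_le tendsto_const_nhds hlim' (fun _ => zero_le) hle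

/-- The curve of marginals `t ↦ (e_t)_♯ η`, an element of `C([0,T]; 𝒫_p(X))`. The latter space
carries the topology of uniform convergence, which is the compact-open one. -/
def marginalCurve {p : ℝ} [Fact (1 ≤ p)] (η : WassersteinSpace p C(Icc (0 : ℝ) T, X)) :
    C(Icc (0 : ℝ) T, WassersteinSpace p X) :=
  ⟨marginal η, continuous_marginal η⟩

end Paths

end

/-!
A curve of finite action satisfies the Hölder estimate
`d(γ_s, γ_t) ≤ |s - t|^(1 - 1/p) 𝒜_p(γ)^(1/p)`. Under the bound on the actions a random curve is
therefore determined, up to an error that is small in `L^p` uniformly over `K`, by its positions at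
a finite net of times; at each of these times the positions are uniformly `L^p`-close to a finite
set, because the marginals are relatively compact. So `K` is uniformly `L^p`-close to a finite set
of curves.

For families of probability measures this is total boundedness with respect to `W_p`: moving every
point to a nearest point of the finite set `F` reduces the family to the simplex of probability
measures on `F`, which is compact. Finally `W_p` is complete: disintegrating almost optimal
couplings between successive terms of a fast Cauchy sequence gives the transitions of a Markov
chain, which converges almost surely and in `L^p`.
-/

section PowerMean

variable {Ω : Type*} [MeasurableSpace Ω]

lemma lintegral_le_lintegral_rpow_mul_measure_univ_rpow {p : ℝ} (hp : 1 ≤ p) (μ : Measure Ω)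
    (f : Ω → ℝ≥0∞) :
    ∫⁻ x, f x ∂μ ≤ (∫⁻ x, f x ^ p ∂μ) ^ (1 / p) * μ univ ^ (1 - 1 / p) := by
  obtain ⟨g, hg, hgf, hfg⟩ := exists_measurable_le_lintegral_eq μ f
  have hL : eLpNorm g 1 μ ≤ eLpNorm g (ENNReal.ofReal p) μ * μ univ ^ (1 - 1 / p) := by
    simpa [ENNReal.toReal_ofReal (zero_le_one.trans hp)] using
      eLpNorm_le_eLpNorm_mul_rpow_measure_univ (p := 1) (q := ENNReal.ofReal p)
        (by simpa using hp) hg.aestronglyMeasurable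
  have hp0 : 0 < p := by linarith
  rw [eLpNorm_one_eq_lintegral_enorm, eLpNorm_eq_lintegral_rpow_enorm_toReal (by simpa) (by simp),
    ENNReal.toReal_ofReal hp0.le] at hL
  simp only [enorm_eq_self] at hL
  rw [hfg]
  refine hL.trans ?_
  gcongr with x
  exact hgf x

end PowerMean

section HoelderEstimate

lemma absolutelyContinuousOnInterval_of_dist_le {X Y : Type*} [PseudoMetricSpace X]
    [PseudoMetricSpace Y] {f : ℝ → X} {g : ℝ → Y} {a b : ℝ}
    (hg : AbsolutelyContinuousOnInterval g a b)
    (h : ∀ x ∈ uIcc a b, ∀ y ∈ uIcc a b, dist (f x) (f y) ≤ dist (g x) (g y)) :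
    AbsolutelyContinuousOnInterval f a b := by
  rw [absolutelyContinuousOnInterval_iff] at hg ⊢
  intro ε hε
  obtain ⟨δ, hδ, H⟩ := hg ε hε
  refine ⟨δ, hδ, fun E hE hlt => (Finset.sum_le_sum fun i hi => ?_).trans_lt (H E hE hlt)⟩
  exact h _ (hE.1 i hi).1 _ (hE.1 i hi).2

variable {X : Type*} [MetricSpace X] {T : ℝ}

lemma IsACp.absolutelyContinuousOnInterval_dist {p : ℝ} (hp : 1 ≤ p) (hT : 0 ≤ T)
    {γ : C(Icc (0 : ℝ) T, X)} (h : IsACp p γ) (x : X) :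
    AbsolutelyContinuousOnInterval (fun t => dist x (γ (projIcc 0 T hT t))) 0 T := by
  obtain ⟨m, hm, hγ⟩ := h
  have hm1 : IntervalIntegrable m volume 0 T := by
    rw [intervalIntegrable_iff_integrableOn_Icc_of_le hT]
    exact hm.integrable (by simpa using hp)
  have hint : ∀ u ∈ Icc 0 T, IntervalIntegrable m volume 0 u := fun u hu =>
    hm1.mono_set <| by rw [uIcc_of_le hT, uIcc_of_le hu.1]; exact Icc_subset_Icc_right hu.2
  refine absolutelyContinuousOnInterval_of_dist_le
    (hm1.absolutelyContinuousOnInterval_intervalIntegral (c := 0) (by simp)) ?_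
  rw [uIcc_of_le hT]
  intro u hu v hv
  wlog huv : u ≤ v generalizing u v
  · rw [dist_comm, dist_comm (∫ r in (0 : ℝ)..u, m r)]
    exact this v hv u hu (le_of_not_ge huv)
  calc dist (dist x (γ (projIcc 0 T hT u))) (dist x (γ (projIcc 0 T hT v)))
      ≤ dist (γ ⟨u, hu⟩) (γ ⟨v, hv⟩) := by
        rw [projIcc_of_mem hT hu, projIcc_of_mem hT hv]
        exact dist_dist_dist_le_right _ _ _
    _ ≤ ∫ r in u..v, m r := hγ ⟨u, hu⟩ ⟨v, hv⟩ huv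
    _ = (∫ r in (0 : ℝ)..v, m r) - ∫ r in (0 : ℝ)..u, m r :=
        (intervalIntegral.integral_interval_sub_left (hint v hv) (hint u hu)).symm
    _ ≤ dist (∫ r in (0 : ℝ)..u, m r) (∫ r in (0 : ℝ)..v, m r) := by
        rw [dist_comm]
        exact le_abs_self _

lemma enorm_deriv_dist_le_metricDerivative (hT : 0 < T) (γ : C(Icc (0 : ℝ) T, X)) (x : X)
    (t : Icc (0 : ℝ) T)
    (hd : DifferentiableAt ℝ (fun t => dist x (γ (projIcc 0 T hT.le t))) t) :
    ‖deriv (fun t => dist x (γ (projIcc 0 T hT.le t))) t‖ₑ ≤ metricDerivative γ t := by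
  have : Nontrivial (Icc (0 : ℝ) T) :=
    ⟨⟨⟨0, le_rfl, hT.le⟩, ⟨T, hT.le, le_rfl⟩, by simpa [Subtype.ext_iff] using hT.ne⟩⟩
  have : PreconnectedSpace (Icc (0 : ℝ) T) :=
    isPreconnected_iff_preconnectedSpace.1 isPreconnected_Icc
  have hcoe : Tendsto ((↑) : Icc (0 : ℝ) T → ℝ) (𝓝[≠] t) (𝓝[≠] (t : ℝ)) :=
    tendsto_nhdsWithin_of_tendsto_nhds_of_eventually_within _
      (continuous_subtype_val.continuousAt.tendsto.mono_left nhdsWithin_le_nhds)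
      (eventually_nhdsWithin_of_forall fun s hs => by simpa [Subtype.ext_iff] using hs)
  have hslope := ((hasDerivAt_iff_tendsto_slope.1 hd.hasDerivAt).comp hcoe).enorm
  rw [← hslope.limsup_eq]
  refine limsup_le_limsup (eventually_nhdsWithin_of_forall fun s hs => ?_)
  have hs' : (s : ℝ) - t ≠ 0 := sub_ne_zero.2 (by simpa [Subtype.ext_iff] using hs)
  simp only [Function.comp_apply, slope_def_module, projIcc_val, smul_eq_mul, enorm_mul]
  rw [enorm_inv hs', mul_comm, ← div_eq_mul_inv, Subtype.edist_eq, edist_eq_enorm_sub (s : ℝ)]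
  gcongr
  rw [← edist_eq_enorm_sub, edist_dist, edist_dist]
  exact ENNReal.ofReal_le_ofReal (dist_dist_dist_le_right _ _ _)

lemma IsACp.edist_le_setLIntegral_metricDerivative {p : ℝ} (hp : 1 ≤ p)
    {γ : C(Icc (0 : ℝ) T, X)} (hγ : IsACp p γ) {s t : Icc (0 : ℝ) T} (hst : s ≤ t) :
    edist (γ s) (γ t) ≤ ∫⁻ r in Icc s t, metricDerivative γ r ∂(volume.comap Subtype.val) := by
  rcases hst.eq_or_lt with rfl | hlt
  · simp
  have hT : 0 < T := s.2.1.trans_lt (lt_of_lt_of_le hlt t.2.2)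
  have hst' : (s : ℝ) ≤ t := hst
  set f : ℝ → ℝ := fun r => dist (γ s) (γ (projIcc 0 T hT.le r)) with hf
  have hac : AbsolutelyContinuousOnInterval f 0 T :=
    hγ.absolutelyContinuousOnInterval_dist hp hT.le (γ s)
  have hac' : AbsolutelyContinuousOnInterval f s t := hac.mono <| by
    rw [uIcc_of_le hst', uIcc_of_le hT.le]
    exact Icc_subset_Icc s.2.1 t.2.2
  have hderiv : ∀ᵐ r : Icc (0 : ℝ) T ∂(volume.comap Subtype.val),
      ‖deriv f r‖ₑ ≤ metricDerivative γ r := by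
    filter_upwards [(measurePreserving_subtype_coe
      measurableSet_Icc).quasiMeasurePreserving.ae (ae_restrict_of_ae hac.ae_differentiableAt)]
      with r hr
    exact enorm_deriv_dist_le_metricDerivative hT γ (γ s) r
      (hr (by rw [uIcc_of_le hT.le]; exact r.2))
  calc edist (γ s) (γ t) = ENNReal.ofReal (∫ r in (s : ℝ)..t, deriv f r) := by
        rw [hac'.integral_deriv_eq_sub, edist_dist]
        simp [hf]
    _ ≤ ∫⁻ r in Icc (s : ℝ) t, ‖deriv f r‖ₑ := by
        rw [intervalIntegral.integral_of_le hst', ← integral_Icc_eq_integral_Ioc]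
        exact (Real.ofReal_le_enorm _).trans (enorm_integral_le_lintegral_enorm _)
    _ = ∫⁻ r in Icc s t, ‖deriv f r‖ₑ ∂(volume.comap Subtype.val) := by
        rw [setLIntegral_subtype measurableSet_Icc (Icc s t) fun r => ‖deriv f r‖ₑ,
          image_subtype_val_Icc]
    _ ≤ _ := lintegral_mono_ae (ae_restrict_of_ae hderiv)

lemma comap_subtype_val_volume_Icc {s t : Icc (0 : ℝ) T} (hst : s ≤ t) :
    (volume.comap Subtype.val : Measure (Icc (0 : ℝ) T)) (Icc s t) = edist s t := by
  rw [(MeasurableEmbedding.subtype_coe measurableSet_Icc).comap_apply, image_subtype_val_Icc,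
    Real.volume_Icc, Subtype.edist_eq, edist_comm, edist_dist, Real.dist_eq,
    abs_of_nonneg (sub_nonneg.2 (Subtype.coe_le_coe.2 hst))]

lemma edist_le_edist_rpow_mul_pAction {p : ℝ} (hp : 1 ≤ p)
    (γ : C(Icc (0 : ℝ) T, X)) (s t : Icc (0 : ℝ) T) :
    edist (γ s) (γ t) ≤ edist s t ^ (1 - 1 / p) * pAction p γ ^ (1 / p) := by
  wlog hst : s ≤ t generalizing s t
  · rw [edist_comm, edist_comm s]
    exact this t s (le_of_not_ge hst)
  rcases hst.eq_or_lt with rfl | hlt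
  · simp
  by_cases hγ : IsACp p γ
  · calc edist (γ s) (γ t)
        ≤ ∫⁻ r in Icc s t, metricDerivative γ r ∂(volume.comap Subtype.val) :=
          hγ.edist_le_setLIntegral_metricDerivative hp hst
      _ ≤ (∫⁻ r in Icc s t, metricDerivative γ r ^ p ∂(volume.comap Subtype.val)) ^ (1 / p)
            * edist s t ^ (1 - 1 / p) := by
          refine (lintegral_le_lintegral_rpow_mul_measure_univ_rpow hp _ _).trans_eq ?_
          rw [Measure.restrict_apply_univ, comap_subtype_val_volume_Icc hst]
      _ ≤ edist s t ^ (1 - 1 / p) * pAction p γ ^ (1 / p) := by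
          rw [mul_comm, pAction, if_pos hγ]
          gcongr
          exact Measure.restrict_le_self
  · have hst0 : edist s t ^ (1 - 1 / p) ≠ 0 := by
      simp [ENNReal.rpow_eq_zero_iff, hlt.ne, edist_ne_top]
    rw [pAction, if_neg hγ, ENNReal.top_rpow_of_pos (by positivity), ENNReal.mul_top hst0]
    exact le_top

end HoelderEstimate

section Couplings

lemma map_prodMk_mem_couplings {Ω Y : Type*} [MeasurableSpace Ω] [MeasurableSpace Y]
    {P : Measure Ω} {f g : Ω → Y} (hf : Measurable f) (hg : Measurable g) :
    P.map (fun ω => (f ω, g ω)) ∈ couplings (P.map f) (P.map g) :=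
  ⟨Measure.fst_map_prodMk hg, Measure.snd_map_prodMk hf⟩

lemma add_mem_couplings {Y : Type*} [MeasurableSpace Y] {μ₁ μ₂ ν₁ ν₂ : Measure Y}
    {π₁ π₂ : Measure (Y × Y)} (h₁ : π₁ ∈ couplings μ₁ ν₁) (h₂ : π₂ ∈ couplings μ₂ ν₂) :
    π₁ + π₂ ∈ couplings (μ₁ + μ₂) (ν₁ + ν₂) :=
  ⟨by rw [Measure.fst_add, h₁.1, h₂.1], by rw [Measure.snd_add, h₁.2, h₂.2]⟩

lemma inv_smul_prod_mem_couplings {Y : Type*} [MeasurableSpace Y] {α β : Measure Y}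
    [IsFiniteMeasure α] [IsFiniteMeasure β] (hmass : α univ = β univ) :
    (α univ)⁻¹ • α.prod β ∈ couplings α β := by
  rcases eq_or_ne (α univ) 0 with h0 | h0
  · rw [Measure.measure_univ_eq_zero.1 h0, Measure.measure_univ_eq_zero.1 (hmass.symm.trans h0)]
    simp [couplings]
  · constructor
    · rw [Measure.fst, Measure.map_smul, Measure.map_fst_prod, ← hmass, smul_smul,
        ENNReal.inv_mul_cancel h0 (measure_ne_top _ _), one_smul]
    · rw [Measure.snd, Measure.map_smul, Measure.map_snd_prod, smul_smul,
        ENNReal.inv_mul_cancel h0 (measure_ne_top _ _), one_smul]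

variable {Y : Type*} [MetricSpace Y] [MeasurableSpace Y] [SecondCountableTopology Y] [BorelSpace Y]

lemma wassersteinDist_map_map_le {Ω : Type*} [MeasurableSpace Ω] {P : Measure Ω} {p : ℝ}
    (hp : 1 ≤ p) {f g : Ω → Y} (hf : Measurable f) (hg : Measurable g) :
    wassersteinDist p (P.map f) (P.map g) ≤ (∫⁻ ω, edist (f ω) (g ω) ^ p ∂P) ^ (1 / p) := by
  refine (wassersteinDist_le hp (map_prodMk_mem_couplings hf hg)).trans_eq ?_
  rw [lintegral_map (by fun_prop) (hf.prodMk hg)]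

lemma lintegral_rpow_le_add_wassersteinDist {p : ℝ} (hp : 1 ≤ p) {μ ν : Measure Y} {g : Y → ℝ≥0∞}
    (hg : Measurable g) (hlip : ∀ x y, g x ≤ g y + edist x y) :
    (∫⁻ x, g x ^ p ∂μ) ^ (1 / p)
      ≤ (∫⁻ x, g x ^ p ∂ν) ^ (1 / p) + wassersteinDist p μ ν := by
  refine ENNReal.le_of_forall_pos_le_add fun ε hε hfin => ?_
  obtain ⟨π, ⟨rfl, rfl⟩, hπ⟩ := exists_coupling_of_wassersteinDist_lt hp
    (ENNReal.lt_add_right (ENNReal.add_lt_top.1 hfin).2.ne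
      (ENNReal.coe_ne_zero.2 hε.ne') : wassersteinDist p μ ν < _ + ε)
  rw [Measure.fst, Measure.snd, lintegral_map (hg.pow_const p) measurable_fst,
    lintegral_map (hg.pow_const p) measurable_snd]
  calc (∫⁻ z, g z.1 ^ p ∂π) ^ (1 / p)
      ≤ (∫⁻ z, ((fun z : Y × Y => g z.2) + fun z : Y × Y => edist z.1 z.2) z ^ p ∂π)
          ^ (1 / p) := by
        gcongr with z
        exact hlip _ _
    _ ≤ (∫⁻ z, g z.2 ^ p ∂π) ^ (1 / p) + (∫⁻ z, edist z.1 z.2 ^ p ∂π) ^ (1 / p) :=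
        ENNReal.lintegral_Lp_add_le (hg.comp measurable_snd).aemeasurable (by fun_prop) hp
    _ ≤ _ := by
        rw [add_assoc]
        exact add_le_add le_rfl hπ.le

lemma wassersteinDist_add_add_le {p : ℝ} (hp : 1 ≤ p) (ρ : Measure Y) {α β : Measure Y}
    [IsFiniteMeasure α] [IsFiniteMeasure β] (hmass : α univ = β univ) {D : ℝ≥0∞}
    (hD : ∀ᵐ x ∂α, ∀ᵐ y ∂β, edist x y ≤ D) :
    wassersteinDist p (ρ + α) (ρ + β) ≤ (D ^ p * α univ) ^ (1 / p) := by
  have hp0 : 0 < p := by linarith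
  have hdiag : ρ.map (fun x => (x, x)) ∈ couplings ρ ρ := by
    simpa using map_prodMk_mem_couplings (P := ρ) measurable_id measurable_id
  refine (wassersteinDist_le hp
    (add_mem_couplings hdiag (inv_smul_prod_mem_couplings hmass))).trans ?_
  gcongr
  rw [lintegral_add_measure, lintegral_smul_measure, lintegral_map (by fun_prop) (by fun_prop),
    lintegral_prod _ (by fun_prop)]
  simp only [edist_self, ENNReal.zero_rpow_of_pos hp0, lintegral_zero, zero_add, smul_eq_mul]
  calc (α univ)⁻¹ * ∫⁻ x, ∫⁻ y, edist x y ^ p ∂β ∂α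
      ≤ (α univ)⁻¹ * ∫⁻ _, ∫⁻ _, D ^ p ∂β ∂α := by
        refine mul_le_mul_right (lintegral_mono_ae (hD.mono fun x hx =>
          lintegral_mono_ae (hx.mono fun y hy => ?_))) _
        gcongr
    _ = D ^ p * α univ * ((α univ)⁻¹ * α univ) := by
        rw [lintegral_const, lintegral_const, ← hmass]
        ring
    _ ≤ D ^ p * α univ := mul_le_of_le_one_right' (ENNReal.inv_mul_le_one _)

end Couplings

section FinitelySupported

variable {Y : Type*}

/-- The measure `∑_{y ∈ F} a_y δ_y`, where negative weights count as zero. -/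
noncomputable def discreteMeasure [MeasurableSpace Y] (F : Finset Y) (a : F → ℝ) : Measure Y :=
  ∑ y, ENNReal.ofReal (a y) • Measure.dirac (y : Y)

section Measurable

variable [MeasurableSpace Y] {F : Finset Y}

lemma discreteMeasure_univ (a : F → ℝ) :
    discreteMeasure F a univ = ∑ y, ENNReal.ofReal (a y) := by
  simp [discreteMeasure]

lemma discreteMeasure_univ_of_nonneg {a : F → ℝ} (ha : 0 ≤ a) :
    discreteMeasure F a univ = ENNReal.ofReal (∑ y, a y) := by
  rw [discreteMeasure_univ, ENNReal.ofReal_sum_of_nonneg fun y _ => ha y]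

instance (a : F → ℝ) : IsFiniteMeasure (discreteMeasure F a) :=
  ⟨by rw [discreteMeasure_univ]; simp⟩

lemma discreteMeasure_add {a b : F → ℝ} (ha : 0 ≤ a) (hb : 0 ≤ b) :
    discreteMeasure F (a + b) = discreteMeasure F a + discreteMeasure F b := by
  simp only [discreteMeasure, Pi.add_apply, ENNReal.ofReal_add (ha _) (hb _), add_smul,
    Finset.sum_add_distrib]

variable [MeasurableSingletonClass Y]

lemma ae_discreteMeasure_mem (a : F → ℝ) : ∀ᵐ x ∂discreteMeasure F a, x ∈ F := by
  rw [ae_iff, discreteMeasure, Measure.finsetSum_apply]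
  refine Finset.sum_eq_zero fun y _ => ?_
  have hy : Measure.dirac (y : Y) {x | x ∉ F} = 0 := by
    simp
  simp [hy]

lemma map_coe_eq_discreteMeasure {Ω : Type*} [MeasurableSpace Ω] (μ : Measure Ω)
    [IsFiniteMeasure μ] {q : Ω → F} (hq : Measurable q) :
    μ.map (fun x => (q x : Y)) = discreteMeasure F fun y => μ.real (q ⁻¹' {y}) := by
  have hcoe : Measurable ((↑) : F → Y) := measurable_subtype_coe
  rw [← Function.comp_def, ← Measure.map_map hcoe hq, Measure.map_eq_sum μ q hq,
    Measure.sum_fintype, discreteMeasure, Measure.map_finset_sum hcoe.aemeasurable]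
  simp [Measure.map_smul, Measure.map_dirac' hcoe]

end Measurable

lemma exists_measurable_edist_eq_infEDist [PseudoEMetricSpace Y] [MeasurableSpace Y]
    [OpensMeasurableSpace Y] {F : Finset Y} (hF : F.Nonempty) :
    ∃ q : Y → F, Measurable q ∧ ∀ x, edist x (q x : Y) = Metric.infEDist x F := by
  have : Nonempty F := hF.to_subtype
  obtain ⟨e, he⟩ := exists_surjective_nat F
  choose k hk using he
  set N := Finset.univ.sup k
  refine ⟨fun x => e (SimpleFunc.nearestPtInd (fun n => (e n : Y)) N x),
    (measurable_of_countable e).comp (SimpleFunc.measurable _), fun x => le_antisymm ?_ ?_⟩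
  · refine Metric.le_infEDist.2 fun y hy => ?_
    have hN : k ⟨y, hy⟩ ≤ N := Finset.le_sup (Finset.mem_univ _)
    have h := SimpleFunc.edist_nearestPt_le (fun n => (e n : Y)) x hN
    simp only [hk] at h
    rw [edist_comm, edist_comm x y]
    exact h
  · exact Metric.infEDist_le_edist_of_mem (e _).2

variable [MetricSpace Y] [MeasurableSpace Y] [SecondCountableTopology Y] [BorelSpace Y] {p : ℝ}

/-- The measure `∑_{y ∈ F} w_y δ_y` as an element of `𝒫_p(Y)`, for weights `w` in the simplex. -/
noncomputable def WassersteinSpace.ofStdSimplex [hp : Fact (1 ≤ p)] (F : Finset Y)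
    (w : stdSimplex ℝ F) : WassersteinSpace p Y where
  toMeasure := discreteMeasure F w.1
  isProb := ⟨by rw [discreteMeasure_univ_of_nonneg w.2.1, w.2.2, ENNReal.ofReal_one]⟩
  moment := by
    have : (ae (discreteMeasure F w.1)).NeBot := ae_neBot.2 fun h => by
      have hmass := discreteMeasure_univ_of_nonneg w.2.1
      rw [h, w.2.2] at hmass
      simp at hmass
    obtain ⟨y₀, hy₀⟩ := (ae_discreteMeasure_mem w.1).exists
    refine ⟨y₀, (lintegral_mono_ae (g := fun _ => Metric.ediam (F : Set Y) ^ p) ?_).trans_lt ?_⟩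
    · filter_upwards [ae_discreteMeasure_mem (F := F) w] with x hx
      exact ENNReal.rpow_le_rpow (Metric.edist_le_ediam_of_mem hx hy₀) (by linarith [hp.out])
    · rw [lintegral_const]
      have := F.finite_toSet.isBounded.ediam_ne_top
      have := hp.out
      finiteness

lemma wassersteinDist_discreteMeasure_le (hp : 1 ≤ p) {F : Finset Y} {v w : F → ℝ} (hv : 0 ≤ v)
    (hw : 0 ≤ w) (hvw : ∑ y, v y = ∑ y, w y) :
    wassersteinDist p (discreteMeasure F v) (discreteMeasure F w)
      ≤ (Metric.ediam (F : Set Y) ^ p * ENNReal.ofReal (∑ y, (v y - min (v y) (w y))))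
        ^ (1 / p) := by
  set a : F → ℝ := v - v ⊓ w
  set b : F → ℝ := w - v ⊓ w
  have ha : 0 ≤ a := sub_nonneg.2 inf_le_left
  have hb : 0 ≤ b := sub_nonneg.2 inf_le_right
  have hmass : discreteMeasure F a univ = discreteMeasure F b univ := by
    rw [discreteMeasure_univ_of_nonneg ha, discreteMeasure_univ_of_nonneg hb]
    simp only [a, b, Pi.sub_apply, Finset.sum_sub_distrib, hvw]
  have h := wassersteinDist_add_add_le hp (discreteMeasure F (v ⊓ w)) hmass
    (D := Metric.ediam (F : Set Y)) <| by
      filter_upwards [ae_discreteMeasure_mem a] with x hx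
      filter_upwards [ae_discreteMeasure_mem b] with y hy
      exact Metric.edist_le_ediam_of_mem hx hy
  rwa [← discreteMeasure_add (le_inf hv hw) ha, ← discreteMeasure_add (le_inf hv hw) hb,
    add_sub_cancel, add_sub_cancel, discreteMeasure_univ_of_nonneg ha] at h

variable [CompleteSpace Y] [hp : Fact (1 ≤ p)]

lemma WassersteinSpace.continuous_ofStdSimplex (F : Finset Y) :
    Continuous (ofStdSimplex F : stdSimplex ℝ F → WassersteinSpace p Y) := by
  have hp0 : 0 < p := by linarith [hp.out]
  have hDtop : Metric.ediam (F : Set Y) ^ p ≠ ∞ :=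
    ENNReal.rpow_ne_top_of_nonneg hp0.le F.finite_toSet.isBounded.ediam_ne_top
  refine continuous_iff_continuousAt.2 fun w => tendsto_iff_edist_tendsto_0.2 ?_
  have hsum : Tendsto (fun v : stdSimplex ℝ F => ∑ y, (v.1 y - min (v.1 y) (w.1 y)))
      (𝓝 w) (𝓝 0) := by
    have hcont : Continuous fun v : stdSimplex ℝ F => ∑ y, (v.1 y - min (v.1 y) (w.1 y)) :=
      continuous_finsetSum _ fun y _ => by
        have hy : Continuous fun v : stdSimplex ℝ F => v.1 y :=
          (continuous_apply y).comp continuous_subtype_val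
        exact hy.sub (hy.min continuous_const)
    simpa using hcont.tendsto w
  have hlim := (ENNReal.Tendsto.const_mul (ENNReal.tendsto_ofReal hsum)
    (Or.inr hDtop)).ennrpow_const (1 / p)
  rw [ENNReal.ofReal_zero, mul_zero, ENNReal.zero_rpow_of_pos (by positivity)] at hlim
  exact tendsto_of_tendsto_of_tendsto_of_le_of_le tendsto_const_nhds hlim (fun _ => zero_le)
    fun v => wassersteinDist_discreteMeasure_le hp.out v.2.1 w.2.1 (v.2.2.trans w.2.2.symm)

lemma WassersteinSpace.exists_edist_ofStdSimplex_le (μ : WassersteinSpace p Y) {F : Finset Y}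
    (hF : F.Nonempty) :
    ∃ w, edist μ (ofStdSimplex F w)
      ≤ (∫⁻ x, Metric.infEDist x F ^ p ∂μ.toMeasure) ^ (1 / p) := by
  obtain ⟨q, hq, hqF⟩ := exists_measurable_edist_eq_infEDist hF
  have hcoe : Measurable fun x => (q x : Y) := measurable_subtype_coe.comp hq
  have hmap := map_coe_eq_discreteMeasure μ.toMeasure hq
  have hsum : ∑ y, μ.toMeasure.real (q ⁻¹' {y}) = 1 := by
    rw [sum_measureReal_preimage_singleton _ fun y _ => hq (measurableSet_singleton y)]
    simp
  refine ⟨⟨fun y => μ.toMeasure.real (q ⁻¹' {y}), fun y => measureReal_nonneg, hsum⟩, ?_⟩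
  calc wassersteinDist p μ.toMeasure (discreteMeasure F fun y => μ.toMeasure.real (q ⁻¹' {y}))
      = wassersteinDist p (μ.toMeasure.map id) (μ.toMeasure.map fun x => (q x : Y)) := by
        rw [Measure.map_id, hmap]
    _ ≤ (∫⁻ x, edist (id x) (q x : Y) ^ p ∂μ.toMeasure) ^ (1 / p) :=
        wassersteinDist_map_map_le hp.out measurable_id hcoe
    _ = _ := by simp only [id_eq, hqF]

end FinitelySupported

/-- The measures in `S` are, uniformly, `L^p`-close to finite sets: for each `ε > 0` some finite
set `F` satisfies `∫ d(x, F)^p dμ(x) ≤ ε` for all `μ ∈ S`, with the convention `d(x, ∅) = ∞`. This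
is total boundedness for `W_p` expressed without couplings. -/
def IsUniformlyNearFinite {Y : Type*} [PseudoEMetricSpace Y] [MeasurableSpace Y] (p : ℝ)
    (S : Set (Measure Y)) : Prop :=
  ∀ ε : ℝ≥0∞, ε ≠ 0 → ∃ F : Finset Y, ∀ μ ∈ S, ∫⁻ x, Metric.infEDist x F ^ p ∂μ ≤ ε

namespace WassersteinSpace

variable {Y : Type*} [MetricSpace Y] [MeasurableSpace Y] [SecondCountableTopology Y] [BorelSpace Y]
  {p : ℝ}

lemma exists_finset_lintegral_infEDist_rpow_le (hp : 0 < p) (μ : WassersteinSpace p Y) {ε : ℝ≥0∞}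
    (hε : ε ≠ 0) : ∃ F : Finset Y, ∫⁻ x, Metric.infEDist x F ^ p ∂μ.toMeasure ≤ ε := by
  classical
  obtain ⟨x₀, hx₀⟩ := μ.moment
  have : Nonempty Y := ⟨x₀⟩
  let F (n : ℕ) : Finset Y := insert x₀ ((Finset.range n).image (TopologicalSpace.denseSeq Y))
  have hpointwise (x : Y) : Tendsto (fun n => Metric.infEDist x (F n) ^ p) atTop (𝓝 0) := by
    have hlim : Tendsto (fun n => Metric.infEDist x (F n)) atTop (𝓝 0) := by
      refine ENNReal.tendsto_nhds_zero.2 fun δ hδ => ?_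
      obtain ⟨_, ⟨k, rfl⟩, hk⟩ := EMetric.mem_closure_iff.1
        (TopologicalSpace.denseRange_denseSeq Y x) δ hδ
      filter_upwards [eventually_gt_atTop k] with n hn
      have hkF : TopologicalSpace.denseSeq Y k ∈ F n :=
        Finset.mem_insert_of_mem (Finset.mem_image_of_mem _ (Finset.mem_range.2 hn))
      exact (Metric.infEDist_le_edist_of_mem hkF).trans hk.le
    simpa only [ENNReal.zero_rpow_of_pos hp] using hlim.ennrpow_const p
  have hlim : Tendsto (fun n => ∫⁻ x, Metric.infEDist x (F n) ^ p ∂μ.toMeasure) atTop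
      (𝓝 (∫⁻ _, 0 ∂μ.toMeasure)) := by
    refine tendsto_lintegral_of_dominated_convergence (fun x => edist x x₀ ^ p)
      (fun n => Metric.continuous_infEDist.measurable.pow_const p)
      (fun n => Eventually.of_forall fun x => ?_) hx₀.ne (Eventually.of_forall hpointwise)
    exact ENNReal.rpow_le_rpow
      (Metric.infEDist_le_edist_of_mem (Finset.mem_insert_self x₀ _)) hp.le
  rw [lintegral_zero] at hlim
  obtain ⟨n, hn⟩ := (ENNReal.tendsto_nhds_zero.1 hlim ε (pos_iff_ne_zero.2 hε)).exists
  exact ⟨F n, hn⟩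

variable [CompleteSpace Y] [hp : Fact (1 ≤ p)] {S : Set (WassersteinSpace p Y)}

lemma isUniformlyNearFinite_of_totallyBounded (hS : TotallyBounded S) :
    IsUniformlyNearFinite p (toMeasure '' S) := by
  classical
  intro ε hε
  have hp0 : 0 < p := by linarith [hp.out]
  have hε2 : ε ^ (1 / p) / 2 ≠ 0 := by simp [ENNReal.rpow_eq_zero_iff, hε, hp0.le]
  obtain ⟨N, hN, hcov⟩ := EMetric.totallyBounded_iff.1 hS _ (pos_iff_ne_zero.2 hε2)
  choose F hF using fun μ : WassersteinSpace p Y =>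
    μ.exists_finset_lintegral_infEDist_rpow_le hp0
      (ε := (ε ^ (1 / p) / 2) ^ p) (by simp [ENNReal.rpow_eq_zero_iff, hε, hp0.le])
  refine ⟨hN.toFinset.biUnion F, ?_⟩
  rintro _ ⟨μ, hμ, rfl⟩
  obtain ⟨ν, hν, hμν⟩ := mem_iUnion₂.1 (hcov hμ)
  have hsub : F ν ⊆ hN.toFinset.biUnion F :=
    Finset.subset_biUnion_of_mem F (hN.mem_toFinset.2 hν)
  refine (ENNReal.rpow_le_rpow_iff (z := 1 / p) (by positivity)).1 ?_
  calc (∫⁻ x, Metric.infEDist x (hN.toFinset.biUnion F) ^ p ∂μ.toMeasure) ^ (1 / p)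
      ≤ (∫⁻ x, Metric.infEDist x (F ν) ^ p ∂μ.toMeasure) ^ (1 / p) := by
        gcongr
    _ ≤ (∫⁻ x, Metric.infEDist x (F ν) ^ p ∂ν.toMeasure) ^ (1 / p)
          + wassersteinDist p μ.toMeasure ν.toMeasure :=
        lintegral_rpow_le_add_wassersteinDist hp.out Metric.continuous_infEDist.measurable
          fun x y => Metric.infEDist_le_infEDist_add_edist
    _ ≤ ε ^ (1 / p) / 2 + ε ^ (1 / p) / 2 := by
        gcongr
        · simpa only [one_div, ENNReal.rpow_inv_le_iff hp0] using hF ν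
        · exact le_of_lt hμν
    _ = ε ^ (1 / p) := ENNReal.add_halves _

lemma totallyBounded_of_isUniformlyNearFinite (hS : IsUniformlyNearFinite p (toMeasure '' S)) :
    TotallyBounded S := by
  have hp0 : 0 < p := by linarith [hp.out]
  rcases S.eq_empty_or_nonempty with rfl | ⟨μ₀, hμ₀⟩
  · exact totallyBounded_empty
  refine EMetric.totallyBounded_iff.2 fun ε hε => ?_
  obtain ⟨δ, hδ, hδε⟩ := exists_between hε
  have hδ2 : δ / 2 ≠ 0 := by simp [hδ.ne']
  have hδ2_top : δ / 2 ≠ ∞ := ENNReal.div_ne_top hδε.ne_top two_ne_zero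
  obtain ⟨F, hFS⟩ := hS ((δ / 2) ^ p) (by simp [ENNReal.rpow_eq_zero_iff, hδ2, hp0.le])
  replace hFS := forall_mem_image.1 hFS
  have hF : F.Nonempty := by
    by_contra hF
    have h := hFS hμ₀
    simp [Finset.not_nonempty_iff_eq_empty.1 hF, ENNReal.top_rpow_of_pos hp0, hδ2_top,
      hp0.not_gt] at h
  obtain ⟨N, hN, hcov⟩ := EMetric.totallyBounded_iff.1
    (isCompact_range (continuous_ofStdSimplex (p := p) F)).totallyBounded (δ / 2)
    (pos_iff_ne_zero.2 hδ2)
  refine ⟨N, hN, fun μ hμ => ?_⟩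
  have hFμ : (∫⁻ x, Metric.infEDist x F ^ p ∂μ.toMeasure) ^ (1 / p) ≤ δ / 2 := by
    simpa only [one_div, ENNReal.rpow_inv_le_iff hp0] using hFS hμ
  obtain ⟨w, hw⟩ := μ.exists_edist_ofStdSimplex_le hF
  obtain ⟨ν, hν, hwν⟩ := mem_iUnion₂.1 (hcov (mem_range_self w))
  refine mem_iUnion₂.2 ⟨ν, hν, lt_of_le_of_lt ?_ hδε⟩
  calc edist μ ν ≤ edist μ (ofStdSimplex F w) + edist (ofStdSimplex F w) ν := edist_triangle _ _ _
    _ ≤ δ / 2 + δ / 2 := add_le_add (hw.trans hFμ) (le_of_lt hwν)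
    _ = δ := ENNReal.add_halves δ

theorem totallyBounded_iff_isUniformlyNearFinite :
    TotallyBounded S ↔ IsUniformlyNearFinite p (toMeasure '' S) :=
  ⟨isUniformlyNearFinite_of_totallyBounded, totallyBounded_of_isUniformlyNearFinite⟩

end WassersteinSpace

section MarkovChain

lemma map_compProd_comap {α β γ : Type*} [MeasurableSpace α] [MeasurableSpace β]
    [MeasurableSpace γ] (ν : Measure α) [SFinite ν] (κ : Kernel β γ) [IsSFiniteKernel κ]
    {f : α → β} (hf : Measurable f) :
    (ν ⊗ₘ κ.comap f hf).map (fun z => (f z.1, z.2)) = ν.map f ⊗ₘ κ := by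
  ext s hs
  have hm : Measurable fun z : α × γ => (f z.1, z.2) := by fun_prop
  rw [Measure.map_apply hm hs, Measure.compProd_apply (hm hs), Measure.compProd_apply hs,
    lintegral_map (Kernel.measurable_kernel_prodMk_left hs) hf]
  rfl

variable {Y : Type*} [MeasurableSpace Y]

/-- The law on `ℕ → Y` of the inhomogeneous Markov chain with initial law `ν` and transition
kernel `κ n` from time `n` to time `n + 1`. -/
noncomputable def markovChainMeasure (ν : Measure Y) (κ : ℕ → Kernel Y Y)
    [∀ n, IsMarkovKernel (κ n)] : Measure (ℕ → Y) :=
  Kernel.trajMeasure (X := fun _ => Y) ν fun n =>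
    (κ n).comap (fun x => x ⟨n, Finset.mem_Iic.2 le_rfl⟩) (measurable_pi_apply _)

variable (ν : Measure Y) (κ : ℕ → Kernel Y Y) [∀ n, IsMarkovKernel (κ n)]

instance [IsProbabilityMeasure ν] : IsProbabilityMeasure (markovChainMeasure ν κ) :=
  inferInstanceAs (IsProbabilityMeasure (Kernel.trajMeasure _ _))

lemma map_zero_markovChainMeasure : (markovChainMeasure ν κ).map (fun x => x 0) = ν := by
  have h : (markovChainMeasure ν κ).map (Preorder.frestrictLe 0)
      = ν.map (MeasurableEquiv.piUnique (fun _ : Finset.Iic 0 => Y)).symm := by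
    rw [markovChainMeasure, Kernel.trajMeasure, Measure.map_comp _ _ (by fun_prop),
      Kernel.traj_map_frestrictLe, Kernel.partialTraj_self, Measure.id_comp]
  have h' := congrArg (Measure.map fun x => x ⟨0, Finset.mem_Iic.2 le_rfl⟩) h
  rw [Measure.map_map (by fun_prop) (by fun_prop), Measure.map_map (by fun_prop) (by fun_prop)]
    at h'
  exact h'.trans Measure.map_id

lemma map_prodMk_succ_markovChainMeasure [IsProbabilityMeasure ν] (n : ℕ) :
    (markovChainMeasure ν κ).map (fun x => (x n, x (n + 1)))
      = (markovChainMeasure ν κ).map (fun x => x n) ⊗ₘ κ n := by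
  have hlast : Measurable fun x : Finset.Iic n → Y => x ⟨n, Finset.mem_Iic.2 le_rfl⟩ :=
    measurable_pi_apply _
  have h := map_compProd_comap ((markovChainMeasure ν κ).map (Preorder.frestrictLe n)) (κ n) hlast
  rw [Measure.map_map hlast (by fun_prop)] at h
  refine Eq.trans ?_ h
  rw [markovChainMeasure, Kernel.map_frestrictLe_trajMeasure_compProd_eq_map_trajMeasure,
    Measure.map_map (by fun_prop) (by fun_prop)]
  rfl

lemma exists_measure_map_prodMk_succ_eq [StandardBorelSpace Y] {μ : ℕ → Measure Y}
    [∀ n, IsProbabilityMeasure (μ n)] {π : ℕ → Measure (Y × Y)}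
    (hπ : ∀ n, π n ∈ couplings (μ n) (μ (n + 1))) :
    ∃ P : Measure (ℕ → Y), IsProbabilityMeasure P ∧
      ∀ n, P.map (fun x => (x n, x (n + 1))) = π n := by
  have : Nonempty Y := nonempty_of_isProbabilityMeasure (μ 0)
  have : ∀ n, IsProbabilityMeasure (π n) := fun n =>
    ⟨by rw [← Measure.fst_univ, (hπ n).1]; exact measure_univ⟩
  have hdisint (n : ℕ) : μ n ⊗ₘ (π n).condKernel = π n := by
    rw [← (hπ n).1, (π n).disintegrate]
  set P := markovChainMeasure (μ 0) fun n => (π n).condKernel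
  have hmarg (n : ℕ) : P.map (fun x => x n) = μ n := by
    induction n with
    | zero => exact map_zero_markovChainMeasure _ _
    | succ n ih =>
      have h := congrArg Measure.snd (map_prodMk_succ_markovChainMeasure (μ 0)
        (fun n => (π n).condKernel) n)
      rwa [ih, hdisint, (hπ n).2, Measure.snd_map_prodMk (by fun_prop)] at h
  refine ⟨P, inferInstance, fun n => ?_⟩
  rw [map_prodMk_succ_markovChainMeasure, hmarg, hdisint]

end MarkovChain

section Completeness

variable {Ω Y : Type*} [MeasurableSpace Ω] {P : Measure Ω} [MetricSpace Y] [MeasurableSpace Y]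
  [SecondCountableTopology Y] [BorelSpace Y] {p : ℝ} {f : ℕ → Ω → Y}

lemma lintegral_edist_rpow_le_sum (hp : 1 ≤ p) (hf : ∀ n, Measurable (f n)) (n k : ℕ) :
    (∫⁻ ω, edist (f n ω) (f (n + k) ω) ^ p ∂P) ^ (1 / p)
      ≤ ∑ j ∈ Finset.range k,
        (∫⁻ ω, edist (f (n + j) ω) (f (n + j + 1) ω) ^ p ∂P) ^ (1 / p) := by
  have hp0 : 0 < p := by linarith
  induction k with
  | zero => simp [hp0]
  | succ k ih =>
    rw [Finset.sum_range_succ]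
    calc (∫⁻ ω, edist (f n ω) (f (n + (k + 1)) ω) ^ p ∂P) ^ (1 / p)
        ≤ (∫⁻ ω, ((fun ω => edist (f n ω) (f (n + k) ω))
            + fun ω => edist (f (n + k) ω) (f (n + k + 1) ω)) ω ^ p ∂P) ^ (1 / p) := by
          gcongr with ω
          exact edist_triangle _ _ _
      _ ≤ (∫⁻ ω, edist (f n ω) (f (n + k) ω) ^ p ∂P) ^ (1 / p)
            + (∫⁻ ω, edist (f (n + k) ω) (f (n + k + 1) ω) ^ p ∂P) ^ (1 / p) :=
          ENNReal.lintegral_Lp_add_le ((hf _).edist (hf _)).aemeasurable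
            ((hf _).edist (hf _)).aemeasurable hp
      _ ≤ _ := by gcongr

lemma WassersteinSpace.exists_lintegral_edist_rpow_lt_top (hp : 1 ≤ p)
    (μ : WassersteinSpace p Y) {ν : Measure Y} (h : wassersteinDist p ν μ.toMeasure ≠ ∞) :
    ∃ x₀, ∫⁻ x, edist x x₀ ^ p ∂ν < ∞ := by
  obtain ⟨x₀, hx₀⟩ := μ.moment
  refine ⟨x₀, ?_⟩
  have hlip := lintegral_rpow_le_add_wassersteinDist hp (μ := ν) (ν := μ.toMeasure)
    (g := fun x => edist x x₀) (by fun_prop)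
    fun x y => (edist_triangle x y x₀).trans_eq (add_comm _ _)
  rw [← ENNReal.rpow_lt_top_iff_of_pos (y := 1 / p) (by positivity)]
  exact hlip.trans_lt (ENNReal.add_lt_top.2
    ⟨ENNReal.rpow_lt_top_of_nonneg (by positivity) hx₀.ne, h.lt_top⟩)

variable [CompleteSpace Y]

lemma ae_exists_tendsto_of_tsum_lintegral_edist_rpow_ne_top [IsFiniteMeasure P] (hp : 1 ≤ p)
    (hf : ∀ n, Measurable (f n))
    (hsum : ∑' n, (∫⁻ ω, edist (f n ω) (f (n + 1) ω) ^ p ∂P) ^ (1 / p) ≠ ∞) :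
    ∀ᵐ ω ∂P, ∃ y, Tendsto (fun n => f n ω) atTop (𝓝 y) := by
  have hm (n : ℕ) : Measurable fun ω => edist (f n ω) (f (n + 1) ω) := (hf n).edist (hf (n + 1))
  have hint : ∫⁻ ω, ∑' n, edist (f n ω) (f (n + 1) ω) ∂P ≠ ∞ := by
    rw [lintegral_tsum fun n => (hm n).aemeasurable]
    refine ne_top_of_le_ne_top ?_ (ENNReal.tsum_le_tsum fun n =>
      lintegral_le_lintegral_rpow_mul_measure_univ_rpow hp P _)
    rw [ENNReal.tsum_mul_right]
    have hexp : 0 ≤ 1 - 1 / p := sub_nonneg.2 ((div_le_one (by linarith)).2 hp)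
    exact ENNReal.mul_ne_top hsum (ENNReal.rpow_ne_top_of_nonneg hexp (measure_ne_top P _))
  filter_upwards [ae_lt_top (Measurable.tsum hm) hint] with ω hω
  exact cauchySeq_tendsto_of_complete
    (cauchySeq_of_edist_le_of_tsum_ne_top _ (fun n => le_rfl) hω.ne)

lemma exists_measurable_lintegral_edist_rpow_le_tsum [IsFiniteMeasure P] (hp : 1 ≤ p)
    (hf : ∀ n, Measurable (f n))
    (hsum : ∑' n, (∫⁻ ω, edist (f n ω) (f (n + 1) ω) ^ p ∂P) ^ (1 / p) ≠ ∞) :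
    ∃ g : Ω → Y, Measurable g ∧ ∀ n, (∫⁻ ω, edist (f n ω) (g ω) ^ p ∂P) ^ (1 / p)
      ≤ ∑' j, (∫⁻ ω, edist (f (n + j) ω) (f (n + j + 1) ω) ^ p ∂P) ^ (1 / p) := by
  have hp0 : 0 < p := by linarith
  obtain ⟨g, hg, hlim⟩ := measurable_limit_of_tendsto_metrizable_ae
    (fun n => (hf n).aemeasurable)
    (ae_exists_tendsto_of_tsum_lintegral_edist_rpow_ne_top hp hf hsum)
  refine ⟨g, hg, fun n => ?_⟩
  set a := ∑' j, (∫⁻ ω, edist (f (n + j) ω) (f (n + j + 1) ω) ^ p ∂P) ^ (1 / p)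
  have hfin (k : ℕ) : ∫⁻ ω, edist (f n ω) (f (n + k) ω) ^ p ∂P ≤ a ^ p := by
    rw [← ENNReal.rpow_inv_le_iff hp0, ← one_div]
    exact (lintegral_edist_rpow_le_sum hp hf n k).trans (ENNReal.sum_le_tsum _)
  rw [one_div, ENNReal.rpow_inv_le_iff hp0]
  calc ∫⁻ ω, edist (f n ω) (g ω) ^ p ∂P
      = ∫⁻ ω, liminf (fun k => edist (f n ω) (f (n + k) ω) ^ p) atTop ∂P := by
        refine lintegral_congr_ae (hlim.mono fun ω hω => ?_)
        have hshift : Tendsto (fun k => f (n + k) ω) atTop (𝓝 (g ω)) := by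
          simpa only [add_comm n] using (tendsto_add_atTop_iff_nat n).2 hω
        exact ((tendsto_const_nhds.edist hshift).ennrpow_const p).liminf_eq.symm
    _ ≤ liminf (fun k => ∫⁻ ω, edist (f n ω) (f (n + k) ω) ^ p ∂P) atTop :=
        lintegral_liminf_le fun k => ((hf _).edist (hf _)).pow_const p
    _ ≤ liminf (fun _ : ℕ => a ^ p) atTop := liminf_le_liminf (Eventually.of_forall hfin)
    _ = a ^ p := liminf_const _

instance WassersteinSpace.instCompleteSpace [hp : Fact (1 ≤ p)] :
    CompleteSpace (WassersteinSpace p Y) := by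
  refine EMetric.complete_of_convergent_controlled_sequences (fun n => (2 : ℝ≥0∞)⁻¹ ^ n)
    (fun n => ENNReal.pow_pos (by simp) n) fun u hu => ?_
  choose π hπ hlt using fun n => exists_coupling_of_wassersteinDist_lt hp.out
    (hu n n (n + 1) le_rfl n.le_succ)
  obtain ⟨P, hPprob, hP⟩ := exists_measure_map_prodMk_succ_eq hπ
  have hmarg (n : ℕ) : P.map (fun x => x n) = (u n).toMeasure := by
    rw [← (hπ n).1, ← hP n, Measure.fst_map_prodMk (by fun_prop)]
  have hstep (n : ℕ) : (∫⁻ x, edist (x n) (x (n + 1)) ^ p ∂P) ^ (1 / p) ≤ (2 : ℝ≥0∞)⁻¹ ^ n := by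
    have h := (hlt n).le
    rwa [← hP n, lintegral_map (by fun_prop) (by fun_prop)] at h
  obtain ⟨Z, hZ, hPZ⟩ := exists_measurable_lintegral_edist_rpow_le_tsum (P := P) hp.out
    (f := fun n x => x n) (fun n => measurable_pi_apply n)
    (ne_top_of_le_ne_top (by simp) (ENNReal.tsum_le_tsum hstep))
  have hdist (n : ℕ) : wassersteinDist p (u n).toMeasure (P.map Z) ≤ 2⁻¹ ^ n * 2 := by
    calc wassersteinDist p (u n).toMeasure (P.map Z)
        ≤ (∫⁻ x, edist (x n) (Z x) ^ p ∂P) ^ (1 / p) := by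
          rw [← hmarg]
          exact wassersteinDist_map_map_le hp.out (by fun_prop) hZ
      _ ≤ ∑' j, (2 : ℝ≥0∞)⁻¹ ^ (n + j) :=
          (hPZ n).trans (ENNReal.tsum_le_tsum fun j => hstep (n + j))
      _ = 2⁻¹ ^ n * 2 := by
          simp only [pow_add, ENNReal.tsum_mul_left, ENNReal.tsum_geometric_two]
  refine ⟨⟨P.map Z, Measure.isProbabilityMeasure_map hZ.aemeasurable,
    (u 0).exists_lintegral_edist_rpow_lt_top hp.out ?_⟩, tendsto_iff_edist_tendsto_0.2 ?_⟩
  · rw [wassersteinDist_comm]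
    exact ((hdist 0).trans_lt (by simp)).ne
  · have hlim : Tendsto (fun n : ℕ => (2 : ℝ≥0∞)⁻¹ ^ n * 2) atTop (𝓝 0) := by
      simpa using ENNReal.Tendsto.mul_const
        (ENNReal.tendsto_pow_atTop_nhds_zero_of_lt_one (r := 2⁻¹) (by simp)) (b := 2)
        (Or.inr (by simp))
    exact tendsto_of_tendsto_of_tendsto_of_le_of_le tendsto_const_nhds hlim (fun _ => zero_le) hdist

end Completeness

lemma exists_finset_forall_exists_le_add {ι Z : Type*} [Finite ι] (J : ι → Z → ℝ≥0∞) {ε : ℝ≥0∞}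
    (hε : ε ≠ 0) : ∃ G : Finset Z, ∀ i z, ∃ z₀ ∈ G, J i z₀ ≤ J i z + ε := by
  classical
  cases nonempty_fintype ι
  rcases isEmpty_or_nonempty Z with hZ | hZ
  · exact ⟨∅, fun _ z => hZ.elim z⟩
  have hmin (i : ι) : ∃ z₀, ∀ z, J i z₀ ≤ J i z + ε := by
    rcases eq_or_ne (⨅ z, J i z) ∞ with h | h
    · exact ⟨Classical.arbitrary Z, fun z => by simp [iInf_eq_top.1 h z]⟩
    · obtain ⟨z₀, hz₀⟩ := exists_lt_of_ciInf_lt (ENNReal.lt_add_right h hε)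
      exact ⟨z₀, fun z => hz₀.le.trans (add_le_add_left (iInf_le _ z) ε)⟩
  choose z₀ hz₀ using hmin
  exact ⟨Finset.univ.image z₀, fun i z => ⟨z₀ i, by simp, hz₀ i z⟩⟩

section ModulusOfContinuity

variable {S X : Type*} [PseudoEMetricSpace S]

/-- The modulus of continuity of `γ` at scale `δ`, the largest distance between the values of `γ`
at two points at distance at most `δ`. -/
noncomputable def modulusOfContinuity [PseudoEMetricSpace X] (γ : S → X) (δ : ℝ≥0∞) : ℝ≥0∞ :=
  ⨆ (s) (t) (_ : edist s t ≤ δ), edist (γ s) (γ t)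

lemma edist_le_modulusOfContinuity [PseudoEMetricSpace X] (γ : S → X) {s t : S} {δ : ℝ≥0∞}
    (h : edist s t ≤ δ) : edist (γ s) (γ t) ≤ modulusOfContinuity γ δ :=
  le_iSup₂_of_le s t (le_iSup_of_le h le_rfl)

variable [CompactSpace S]

lemma exists_finset_forall_exists_edist_le {δ : ℝ≥0∞} (hδ : δ ≠ 0) :
    ∃ I : Finset S, ∀ t, ∃ s ∈ I, edist t s ≤ δ := by
  obtain ⟨I, hIf, hI⟩ := EMetric.totallyBounded_iff.1
    (isCompact_univ (X := S)).totallyBounded δ (pos_iff_ne_zero.2 hδ)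
  refine ⟨hIf.toFinset, fun t => ?_⟩
  obtain ⟨s, hs, hts⟩ := mem_iUnion₂.1 (hI (mem_univ t))
  exact ⟨s, hIf.mem_toFinset.2 hs, le_of_lt hts⟩

variable [PseudoMetricSpace X]

lemma exists_finset_infEDist_le_modulusOfContinuity {δ : ℝ≥0∞} {I : Finset S}
    (hI : ∀ t, ∃ s ∈ I, edist t s ≤ δ) (F : Finset X) {ε : ℝ≥0∞} (hε : ε ≠ 0) :
    ∃ G : Finset C(S, X), ∀ γ : C(S, X), Metric.infEDist γ G
      ≤ 2 * ((⨆ i : I, Metric.infEDist (γ i) F) + modulusOfContinuity γ δ) + ε := by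
  -- Without geodesics in `X` one cannot interpolate between the points `c i` to get a curve near
  -- `γ`; an almost minimizer of `J c` over all curves takes its place.
  let J (c : I → F) (γ : C(S, X)) : ℝ≥0∞ :=
    (⨆ i : I, edist (γ i) (c i : X)) + modulusOfContinuity γ δ
  have hJ (c : I → F) (γ γ' : C(S, X)) : edist γ γ' ≤ J c γ + J c γ' := by
    rw [ContinuousMap.edist_eq_iSup]
    refine iSup_le fun t => ?_
    obtain ⟨s, hs, hts⟩ := hI t
    have hnear (γ : C(S, X)) : edist (γ t) (c ⟨s, hs⟩ : X) ≤ J c γ := by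
      rw [show J c γ = _ from add_comm _ _]
      exact (edist_triangle _ (γ s) _).trans (add_le_add (edist_le_modulusOfContinuity γ hts)
        (le_iSup (fun i : I => edist (γ i) (c i : X)) ⟨s, hs⟩))
    exact (edist_triangle_right _ _ _).trans (add_le_add (hnear γ) (hnear γ'))
  obtain ⟨G, hG⟩ := exists_finset_forall_exists_le_add J hε
  refine ⟨G, fun γ => ?_⟩
  rcases eq_or_ne (⨆ i : I, Metric.infEDist (γ i) F) ∞ with htop | htop
  · simp [htop]
  have hc (i : I) : ∃ y : F, Metric.infEDist (γ i) F = edist (γ i) (y : X) := by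
    have hF : (F : Set X).Nonempty := by
      by_contra hF
      exact htop (top_le_iff.1 (le_iSup_of_le i (by simp [not_nonempty_iff_eq_empty.1 hF])))
    obtain ⟨y, hy, h⟩ := F.finite_toSet.isCompact.exists_infEDist_eq_edist hF (γ i)
    exact ⟨⟨y, hy⟩, h⟩
  choose c hc using hc
  obtain ⟨γ₀, hγ₀, hle⟩ := hG c γ
  calc Metric.infEDist γ G ≤ edist γ γ₀ := Metric.infEDist_le_edist_of_mem hγ₀
    _ ≤ J c γ + (J c γ + ε) := (hJ c γ γ₀).trans (by gcongr)
    _ = 2 * ((⨆ i : I, Metric.infEDist (γ i) F) + modulusOfContinuity γ δ) + ε := by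
      simp only [J, hc]
      ring

end ModulusOfContinuity

section ArzelaAscoli

lemma rpow_two_mul_iSup_add_add_le {ι : Type*} [Fintype ι] (f : ι → ℝ≥0∞) (a b : ℝ≥0∞) {p : ℝ}
    (hp : 0 < p) :
    (2 * ((⨆ i, f i) + a) + b) ^ p ≤ 5 ^ p * (∑ i, f i ^ p + (a ^ p + b ^ p)) := by
  set m := (∑ i, f i ^ p + (a ^ p + b ^ p)) ^ p⁻¹ with hm
  have hf : ⨆ i, f i ≤ m := iSup_le fun i => (ENNReal.le_rpow_inv_iff hp).2 <|
    (Finset.single_le_sum (f := fun i => f i ^ p) (fun _ _ => zero_le)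
      (Finset.mem_univ i)).trans le_self_add
  have ha : a ≤ m := (ENNReal.le_rpow_inv_iff hp).2 (le_self_add.trans le_add_self)
  have hb : b ≤ m := (ENNReal.le_rpow_inv_iff hp).2 (le_add_self.trans le_add_self)
  calc (2 * ((⨆ i, f i) + a) + b) ^ p ≤ (2 * (m + m) + m) ^ p := by gcongr
    _ = (5 * m) ^ p := by ring_nf
    _ = 5 ^ p * (∑ i, f i ^ p + (a ^ p + b ^ p)) := by
        rw [ENNReal.mul_rpow_of_nonneg _ _ hp.le, hm, ENNReal.rpow_inv_rpow hp.ne']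

variable {S X : Type*} [PseudoEMetricSpace S] [PseudoMetricSpace X]
  [MeasurableSpace X] [BorelSpace X] [MeasurableSpace C(S, X)] [BorelSpace C(S, X)] {p : ℝ}
  {K : Set (Measure C(S, X))}

lemma exists_finset_sum_lintegral_infEDist_rpow_le (hp : 0 ≤ p)
    (hmarg : ∀ s, IsUniformlyNearFinite p (Measure.map (fun γ : C(S, X) => γ s) '' K))
    (I : Finset S) {ε : ℝ≥0∞} (hε : ε ≠ 0) :
    ∃ F : Finset X, ∀ μ ∈ K,
      ∑ i : I, ∫⁻ γ : C(S, X), Metric.infEDist (γ i) F ^ p ∂μ ≤ ε := by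
  classical
  have hεI : ε / I.card ≠ 0 := ENNReal.div_ne_zero.2 ⟨hε, ENNReal.natCast_ne_top _⟩
  choose F hF using fun i : I => hmarg i _ hεI
  refine ⟨Finset.univ.biUnion F, fun μ hμ => ?_⟩
  calc ∑ i : I, ∫⁻ γ : C(S, X), Metric.infEDist (γ i) (Finset.univ.biUnion F) ^ p ∂μ
      ≤ ∑ _i : I, ε / I.card := Finset.sum_le_sum fun i _ => by
        refine le_trans ?_ (hF i _ (mem_image_of_mem _ hμ))
        rw [lintegral_map (Metric.continuous_infEDist.measurable.pow_const p)
          (continuous_eval_const (i : S)).measurable]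
        gcongr
        exact Finset.subset_biUnion_of_mem F (Finset.mem_univ i)
    _ ≤ ε := by
        rw [Finset.sum_const, Finset.card_univ, Fintype.card_coe, nsmul_eq_mul]
        exact ENNReal.mul_div_le

theorem isUniformlyNearFinite_of_modulusOfContinuity [CompactSpace S] (hp : 0 < p)
    (hK : ∀ μ ∈ K, IsProbabilityMeasure μ)
    (hmarg : ∀ s, IsUniformlyNearFinite p (Measure.map (fun γ : C(S, X) => γ s) '' K))
    (hmod : ∀ ε : ℝ≥0∞, ε ≠ 0 → ∃ δ : ℝ≥0∞, δ ≠ 0 ∧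
      ∀ μ ∈ K, ∫⁻ γ, modulusOfContinuity γ δ ^ p ∂μ ≤ ε) :
    IsUniformlyNearFinite p K := by
  intro ε hε
  have h5 : (5 : ℝ≥0∞) ^ p ≠ ∞ := by finiteness
  set θ := ε / (5 ^ p * 3)
  have hθ : θ ≠ 0 := ENNReal.div_ne_zero.2 ⟨hε, by finiteness⟩
  have hθp : (θ ^ (1 / p)) ^ p = θ := by
    rw [← ENNReal.rpow_mul, one_div_mul_cancel hp.ne', ENNReal.rpow_one]
  have hθp0 : θ ^ (1 / p) ≠ 0 := by simp [ENNReal.rpow_eq_zero_iff, hθ, hp.le]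
  obtain ⟨δ, hδ, hmodδ⟩ := hmod θ hθ
  obtain ⟨I, hI⟩ := exists_finset_forall_exists_edist_le (S := S) hδ
  obtain ⟨F, hF⟩ := exists_finset_sum_lintegral_infEDist_rpow_le hp.le hmarg I hθ
  obtain ⟨G, hG⟩ := exists_finset_infEDist_le_modulusOfContinuity hI F hθp0
  refine ⟨G, fun μ hμ => ?_⟩
  have := hK μ hμ
  have hm (i : I) : Measurable fun γ : C(S, X) => Metric.infEDist (γ i) F ^ p :=
    (Metric.continuous_infEDist.measurable.comp
      (continuous_eval_const (i : S)).measurable).pow_const p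
  calc ∫⁻ γ, Metric.infEDist γ G ^ p ∂μ
      ≤ ∫⁻ γ, 5 ^ p * (∑ i : I, Metric.infEDist (γ i) F ^ p
          + (modulusOfContinuity γ δ ^ p + θ)) ∂μ := by
        refine lintegral_mono fun γ => (ENNReal.rpow_le_rpow (hG γ) hp.le).trans ?_
        simpa only [hθp] using
          rpow_two_mul_iSup_add_add_le (fun i : I => Metric.infEDist (γ i) F)
            (modulusOfContinuity γ δ) (θ ^ (1 / p)) hp
    _ = 5 ^ p * (∑ i : I, ∫⁻ γ, Metric.infEDist (γ i) F ^ p ∂μ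
          + (∫⁻ γ, modulusOfContinuity γ δ ^ p ∂μ + θ)) := by
        rw [lintegral_const_mul' _ _ h5,
          lintegral_add_left (Finset.measurable_fun_sum _ fun i _ => hm i),
          lintegral_finsetSum _ fun i _ => hm i, lintegral_add_right _ measurable_const,
          lintegral_const, measure_univ, mul_one]
    _ ≤ 5 ^ p * (θ + (θ + θ)) := by
        gcongr
        · exact hF μ hμ
        · exact hmodδ μ hμ
    _ = 5 ^ p * 3 * θ := by ring
    _ ≤ ε := ENNReal.mul_div_le

end ArzelaAscoli

section Compactness

variable {X : Type*} [MetricSpace X] {T : ℝ} {p : ℝ}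

lemma modulusOfContinuity_le_rpow_mul_pAction (hp : 1 ≤ p) (γ : C(Icc (0 : ℝ) T, X)) (δ : ℝ≥0∞) :
    modulusOfContinuity γ δ ≤ δ ^ (1 - 1 / p) * pAction p γ ^ (1 / p) := by
  have hexp : 0 ≤ 1 - 1 / p := sub_nonneg.2 ((div_le_one (by linarith)).2 hp)
  refine iSup_le fun s => iSup_le fun t => iSup_le fun hst => ?_
  exact (edist_le_edist_rpow_mul_pAction hp γ s t).trans (by gcongr)

lemma lintegral_modulusOfContinuity_rpow_le (hp : 1 < p)
    (μ : Measure C(Icc (0 : ℝ) T, X)) {δ : ℝ≥0∞} (hδ : δ ≠ ∞) :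
    ∫⁻ γ, modulusOfContinuity γ δ ^ p ∂μ ≤ δ ^ (p - 1) * ∫⁻ γ, pAction p γ ∂μ := by
  have hp0 : 0 < p := by linarith
  rw [← lintegral_const_mul' _ _ (ENNReal.rpow_ne_top_of_nonneg (sub_nonneg.2 hp.le) hδ)]
  refine lintegral_mono fun γ => ?_
  calc modulusOfContinuity γ δ ^ p ≤ (δ ^ (1 - 1 / p) * pAction p γ ^ (1 / p)) ^ p :=
        ENNReal.rpow_le_rpow (modulusOfContinuity_le_rpow_mul_pAction hp.le γ δ) hp0.le
    _ = δ ^ (p - 1) * pAction p γ := by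
        rw [ENNReal.mul_rpow_of_nonneg _ _ hp0.le, ← ENNReal.rpow_mul, ← ENNReal.rpow_mul,
          sub_mul, one_div_mul_cancel hp0.ne', one_mul, ENNReal.rpow_one]

lemma exists_forall_lintegral_modulusOfContinuity_rpow_le (hp : 1 < p)
    {A : ℝ≥0∞} (hA : A ≠ ∞) {ε : ℝ≥0∞} (hε : ε ≠ 0) :
    ∃ δ : ℝ≥0∞, δ ≠ 0 ∧ ∀ μ : Measure C(Icc (0 : ℝ) T, X), ∫⁻ γ, pAction p γ ∂μ ≤ A →
      ∫⁻ γ, modulusOfContinuity γ δ ^ p ∂μ ≤ ε := by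
  have hlim : Tendsto (fun δ : ℝ≥0∞ => δ ^ (p - 1) * A) (𝓝[≠] 0) (𝓝 0) := by
    have h := ENNReal.Tendsto.mul_const (b := A)
      ((tendsto_id (x := 𝓝 (0 : ℝ≥0∞))).ennrpow_const (p - 1)) (Or.inr hA)
    rw [ENNReal.zero_rpow_of_pos (sub_pos.2 hp), zero_mul] at h
    exact h.mono_left nhdsWithin_le_nhds
  have hfin : ∀ᶠ δ : ℝ≥0∞ in 𝓝[≠] 0, δ ≠ ∞ :=
    (eventually_ne_nhds ENNReal.zero_ne_top).filter_mono nhdsWithin_le_nhds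
  obtain ⟨δ, hδε, hδ_top, hδ⟩ := ((ENNReal.tendsto_nhds_zero.1 hlim ε (pos_iff_ne_zero.2 hε)).and
    (hfin.and self_mem_nhdsWithin)).exists
  refine ⟨δ, hδ, fun μ hμ => (lintegral_modulusOfContinuity_rpow_le hp μ hδ_top).trans ?_⟩
  exact le_trans (by gcongr) hδε

end Compactness

theorem propositionA4_general {X : Type*} [MetricSpace X] [CompleteSpace X]
    [SecondCountableTopology X] [MeasurableSpace X] [BorelSpace X] (p : ℝ) [Fact (1 ≤ p)]
    (hp : 1 < p) (T : ℝ) (K : Set (WassersteinSpace p C(Icc (0 : ℝ) T, X)))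
    (hA : (⨆ η ∈ K, ∫⁻ γ, pAction p γ ∂η.toMeasure) < ∞)
    (hM : ∀ t, IsCompact (closure ((fun η => marginal η t) '' K))) :
    IsCompact (closure K) := by
  have hmarg (t : Icc (0 : ℝ) T) : IsUniformlyNearFinite p
      (Measure.map (fun γ => γ t) '' (WassersteinSpace.toMeasure '' K)) := by
    have h := WassersteinSpace.totallyBounded_iff_isUniformlyNearFinite.1
      ((hM t).totallyBounded.subset subset_closure)
    rwa [image_image] at h ⊢
  have hmod (ε : ℝ≥0∞) (hε : ε ≠ 0) : ∃ δ : ℝ≥0∞, δ ≠ 0 ∧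
      ∀ μ ∈ WassersteinSpace.toMeasure '' K, ∫⁻ γ, modulusOfContinuity γ δ ^ p ∂μ ≤ ε := by
    obtain ⟨δ, hδ, h⟩ :=
      exists_forall_lintegral_modulusOfContinuity_rpow_le (X := X) (T := T) hp hA.ne hε
    exact ⟨δ, hδ, forall_mem_image.2 fun η hη =>
      h _ (le_iSup₂ (f := fun η _ => ∫⁻ γ, pAction p γ ∂η.toMeasure) η hη)⟩
  have hK : TotallyBounded K := WassersteinSpace.totallyBounded_iff_isUniformlyNearFinite.2 <|
    isUniformlyNearFinite_of_modulusOfContinuity (zero_lt_one.trans hp)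
      (forall_mem_image.2 fun η _ => WassersteinSpace.isProb η) hmarg hmod
  exact hK.closure.isCompact_of_isClosed isClosed_closure

theorem propositionA4 {X : Type*} [MetricSpace X] [CompleteSpace X] [SecondCountableTopology X]
    [MeasurableSpace X] [BorelSpace X] (p : ℝ) [Fact (1 ≤ p)] (hp : 1 < p) (T : ℝ) (hT : 0 < T)
    (K : Set (WassersteinSpace p C(Icc (0 : ℝ) T, X)))
    (hA : (⨆ η ∈ K, ∫⁻ γ, pAction p γ ∂η.toMeasure) < ∞)
    (hB : ∃ x₀ : X, (⨆ η ∈ K,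
      ⨆ x ∈ (marginal η ⟨0, le_rfl, hT.le⟩).toMeasure.support, edist x x₀) < ∞)
    (hC : IsCompact (closure (marginalCurve '' K))) :
    IsCompact (closure K) :=
  propositionA4_general p hp T K hA fun t =>
    (hC.image (continuous_eval_const t)).closure_of_subset <| by
      rintro _ ⟨η, hη, rfl⟩
      exact ⟨marginalCurve η, subset_closure ⟨η, hη, rfl⟩, rfl⟩
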